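/- Let $E$ be a Lusin topological space (a homeomorph of a Borel subset of a compact metric space), let $B(E)^+$ be the set of nonnegative bounded Borel functions on $E$ with the supremum norm $\|\cdot\|$, let $M(E)^\circ$ be the set of nonzero finite Borel measures on $E$, and write $\nu(f)=\int f\,d\nu$. Let $\xi$ be a (possibly non-conservative) Borel right process in $E$ with transition semigroup $(P_t)_{t\ge0}$. Let $b$ be a bounded Borel function on $E$, let $c\in B(E)^+$, let $\eta(x,dy)$ be a bounded kernel on $E$, and let $H(x,d\nu)$ be a $\sigma$-finite kernel from $E$ to $M(E)^\circ$ with $$\sup_{x\in E}\int_{M(E)^\circ}\big[\nu(1)\wedge\nu(1)^2+\nu_x(1)\big]H(x,d\nu)<\infty,$$ where $\nu_x$ is the restriction of $\nu$ to $E\setminus\{x\}$. For $x\in E$, $f\in B(E)^+$ put $$\phi(x,f)=b(x)f(x)+c(x)f(x)^2-\eta(x,f)+\int_{M(E)^\circ}\big[e^{-\nu(f)}-1+f(x)\nu(\{x\})\big]H(x,d\nu).$$ Let $(V_t)_{t\ge0}$ be the cumulant semigroup of the $(\xi,\phi)$-superprocess: for $f\in B(E)^+$, $(t,x)\mapsto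 V_tf(x)$ is the Borel nonnegative solution, bounded on $[0,T]\times E$ for every $T\ge 0$, of $$V_tf(x)=P_tf(x)-\int_0^t ds\int_E\phi(y,V_sf)\,P_{t-s}(x,dy),\qquad t\ge0,\ x\in E.$$ With $\gamma(x,1)=\eta(x,E)+\int_{M(E)^\circ}\nu_x(1)H(x,d\nu)$, the local projection of $\phi$ is $$\phi_1(x,z)=[b(x)-\gamma(x,1)]z+c(x)z^2+\int_{M(E)^\circ}\big[e^{-z\nu(\{x\})}-1+z\nu(\{x\})\big]H(x,d\nu),\qquad z\ge 0.$$ Let $\phi_*(z)=b_*z+c_*z^2+\int_{(0,\infty)}(e^{-zu}-1+zu)\,m_*(du)$ for $z\ge0$, where $b_*\in\mathbb R$, $c_*\ge0$ and $(u\wedge u^2)m_*(du)$ is a finite measure on $(0,\infty)$, and for $\lambda\ge0$ let $t\mapsto v^*_t(\lambda)$ be the nonnegative solution of $$\frac{\partial}{\partial t}v^*_t(\lambda)=-\phi_*(v^*_t(\lambda)),\qquad v^*_0(\lambda)=\lambda .$$ Suppose that $\phi_1(x,z)\ge\phi_*(z)$ for all $x\in E$ and $z\ge0$. Then $$\|V_tf\|\le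 v^*_t(\|f\|)\qquad\text{for all } t\ge0 \text{ and } f\in B(E)^+.$$ -/

import Mathlib

open MeasureTheory ProbabilityTheory Filter Topology
open scoped NNReal ENNReal

noncomputable section

namespace Superprocess

/-- A Lusin topological space: a homeomorph of a Borel subset of a compact metric space. -/
def IsLusinSpace (E : Type*) [TopologicalSpace E] : Prop :=
  ∃ (K : Type) (_ : MetricSpace K) (_ : CompactSpace K) (i : E → K),
    IsEmbedding i ∧ MeasurableSet[borel K] (Set.range i)

/-- Membership in `B(E)⁺`, the nonnegative bounded Borel functions on `E`. -/
structure IsBoundedBorelNonneg {E : Type*} [MeasurableSpace E] (f : E → ℝ) : Prop where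
  measurable : Measurable f
  nonneg : ∀ x, 0 ≤ f x
  bounded : ∃ C : ℝ, ∀ x, f x ≤ C

/-- The supremum norm `‖f‖ = sup_x |f x|`; it is only applied to bounded functions. -/
def supNorm {E : Type*} (f : E → ℝ) : ℝ := ⨆ x, |f x|

/-- A (possibly non-conservative) Borel transition semigroup `(P_t)_{t ≥ 0}` on `E`. -/
structure TransitionSemigroup (E : Type*) [MeasurableSpace E] where
  kernel : ℝ≥0 → Kernel E E
  mass_le_one : ∀ t x, kernel t x Set.univ ≤ 1
  zero : ∀ x, kernel 0 x = Measure.dirac x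
  add : ∀ s t x B, MeasurableSet B →
    kernel (s + t) x B = ∫⁻ y, kernel t y B ∂(kernel s x)

/-- `f : E → [0,∞]` is universally measurable. -/
def IsUniversallyMeasurable {E : Type*} [MeasurableSpace E] (f : E → ℝ≥0∞) : Prop :=
  ∀ μ : Measure E, IsFiniteMeasure μ → AEMeasurable f μ

/-- `f` is `α`-excessive for `(P_t)`: `e^{-αt} P_t f ≤ f` for all `t`, and
`e^{-αt} P_t f → f` pointwise as `t ↓ 0`. -/
structure IsExcessive {E : Type*} [MeasurableSpace E] (P : TransitionSemigroup E)
    (α : ℝ) (f : E → ℝ≥0∞) : Prop where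
  universallyMeasurable : IsUniversallyMeasurable f
  le : ∀ (t : ℝ≥0) (x : E),
    ENNReal.ofReal (Real.exp (-α * t)) * ∫⁻ y, f y ∂(P.kernel t x) ≤ f x
  tendsto : ∀ x : E, Tendsto
    (fun t : ℝ≥0 => ENNReal.ofReal (Real.exp (-α * t)) * ∫⁻ y, f y ∂(P.kernel t x))
    (𝓝[>] 0) (𝓝 (f x))

/-- Extension of a function on `E` to `E ∪ {∂}` by the value `0` at the cemetery `∂`. -/
def extendZero {E : Type*} (f : E → ℝ≥0∞) : E ⊕ Unit → ℝ≥0∞ :=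
  Sum.elim f (fun _ => 0)

/-- A Borel right process `ξ = (Ω, 𝓕, 𝓕_t, ξ_t, 𝐏_x)` in `E` with transition semigroup `(P_t)`.
The process lives in `E ∪ {∂}`, modelled by `E ⊕ Unit`, where the cemetery `∂ = Sum.inr ()` is an
isolated point. The transition semigroup being made of Borel kernels is what "Borel" refers to. -/
structure BorelRightProcess {E : Type*} [TopologicalSpace E] [MeasurableSpace E]
    (P : TransitionSemigroup E) (Ω : Type*) [mΩ : MeasurableSpace Ω] where
  filtration : Filtration ℝ≥0 mΩ
  path : ℝ≥0 → Ω → E ⊕ Unit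
  law : E → Measure Ω
  isProbabilityMeasure_law : ∀ x, IsProbabilityMeasure (law x)
  /-- `x ↦ 𝐏_x(A)` is universally measurable, which allows the filtration to be augmented. -/
  universallyMeasurable_law : ∀ A, MeasurableSet A → IsUniversallyMeasurable (fun x => law x A)
  adapted : ∀ t, Measurable[filtration t] (path t)
  rightContinuous : ∀ ω t, ContinuousWithinAt (fun s => path s ω) (Set.Ici t) t
  /-- `𝐏_x(ξ_0 = x) = 1`. -/
  initial : ∀ x, ∀ᵐ ω ∂(law x), path 0 ω = Sum.inl x
  /-- The simple Markov property: `𝐏_x(ξ_{s+t} ∈ B | 𝓕_s) = P_t(ξ_s, B)` for Borel `B ⊆ E`,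
  where `P_t(∂, B) = 0`. -/
  markov : ∀ (x : E) (s t : ℝ≥0) (A : Set Ω), MeasurableSet[filtration s] A →
    ∀ B : Set E, MeasurableSet B →
      law x (A ∩ path (s + t) ⁻¹' (Sum.inl '' B))
        = ∫⁻ ω in A, extendZero (fun y => P.kernel t y B) (path s ω) ∂(law x)
  /-- For `α > 0` and every `α`-excessive `f`, the map `t ↦ f(ξ_t)` is right continuous almost
  surely under `𝐏_μ = ∫ μ(dx) 𝐏_x`, for each initial law `μ`. -/
  excessive : ∀ (α : ℝ), 0 < α → ∀ f : E → ℝ≥0∞, IsExcessive P α f →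
    ∀ μ : Measure E, IsProbabilityMeasure μ →
      ∃ N : Set Ω, MeasurableSet N ∧ (∫⁻ x, law x N ∂μ = 0) ∧
        ∀ ω, ω ∉ N → ∀ t,
          ContinuousWithinAt (fun s => extendZero f (path s ω)) (Set.Ici t) t

/-- `M(E)° = M(E) \ {0}`, the nonzero finite Borel measures on `E`. Its σ-algebra is generated by
the evaluations `ν ↦ ν(B)`, which is the Borel σ-algebra of the weak topology for Lusin `E`. -/
abbrev NonzeroMeasure (E : Type*) [MeasurableSpace E] : Type _ :=
  {ν : FiniteMeasure E // ν ≠ 0}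

/-- The underlying measure of an element of `M(E)°`. -/
abbrev NonzeroMeasure.meas {E : Type*} [MeasurableSpace E] (ν : NonzeroMeasure E) : Measure E :=
  (ν.1 : Measure E)

/-- The data `(b, c, η, H)` of a branching mechanism on `E`. -/
structure BranchingMechanism (E : Type*) [MeasurableSpace E] where
  b : E → ℝ
  c : E → ℝ
  η : Kernel E E
  H : Kernel E (NonzeroMeasure E)
  measurable_b : Measurable b
  bounded_b : ∃ C : ℝ, ∀ x, |b x| ≤ C
  c_mem : IsBoundedBorelNonneg c
  /-- `η` is a bounded kernel: `sup_x η(x, E) < ∞`. -/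
  isFiniteKernel_η : IsFiniteKernel η
  sigmaFinite_H : ∀ x, SigmaFinite (H x)
  /-- `sup_x ∫ [ν(1) ∧ ν(1)² + ν_x(1)] H(x,dν) < ∞`, with `ν_x` the restriction of `ν` to
  `E \ {x}`. -/
  bounded_H : ∃ C : ℝ≥0, ∀ x,
    ∫⁻ ν, (min (ν.meas Set.univ) (ν.meas Set.univ ^ 2) + ν.meas {x}ᶜ) ∂(H x) ≤ C

namespace BranchingMechanism

variable {E : Type*} [MeasurableSpace E]

/-- `φ(x,f) = b(x)f(x) + c(x)f(x)² - η(x,f) + ∫ [e^{-ν(f)} - 1 + f(x)ν({x})] H(x,dν)`. -/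
def eval (φ : BranchingMechanism E) (x : E) (f : E → ℝ) : ℝ :=
  φ.b x * f x + φ.c x * f x ^ 2 - ∫ y, f y ∂(φ.η x)
    + ∫ ν, (Real.exp (-∫ y, f y ∂ν.meas) - 1 + f x * ν.meas.real {x}) ∂(φ.H x)

/-- `γ(x,1)`, where `γ(x,dy) = η(x,dy) + ∫ ν_x(dy) H(x,dν)`. -/
def gammaMass (φ : BranchingMechanism E) (x : E) : ℝ :=
  (φ.η x).real Set.univ + ∫ ν, ν.meas.real {x}ᶜ ∂(φ.H x)

/-- The local projection
`φ₁(x,z) = [b(x) - γ(x,1)]z + c(x)z² + ∫ [e^{-zν({x})} - 1 + zν({x})] H(x,dν)`. -/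
def localProjection (φ : BranchingMechanism E) (x : E) (z : ℝ) : ℝ :=
  (φ.b x - φ.gammaMass x) * z + φ.c x * z ^ 2
    + ∫ ν, (Real.exp (-(z * ν.meas.real {x})) - 1 + z * ν.meas.real {x}) ∂(φ.H x)

end BranchingMechanism

/-- The data `(b_*, c_*, m_*)` of a spatially independent (CB) branching mechanism. Only the
restriction of `m` to `(0,∞)` is used. -/
structure CBMechanism where
  b : ℝ
  c : ℝ
  m : Measure ℝ
  c_nonneg : 0 ≤ c
  /-- `(u ∧ u²) m(du)` is a finite measure on `(0,∞)`. -/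
  finite_m : ∫⁻ u in Set.Ioi (0 : ℝ), ENNReal.ofReal (min u (u ^ 2)) ∂m < ∞

/-- `φ_*(z) = b_* z + c_* z² + ∫_{(0,∞)} (e^{-zu} - 1 + zu) m_*(du)`. -/
def CBMechanism.eval (φ : CBMechanism) (z : ℝ) : ℝ :=
  φ.b * z + φ.c * z ^ 2 + ∫ u in Set.Ioi (0 : ℝ), (Real.exp (-(z * u)) - 1 + z * u) ∂φ.m

/-- `(V_t)` is the cumulant semigroup of the `(ξ,φ)`-superprocess: for each `f ∈ B(E)⁺`,
`(t,x) ↦ V_t f(x)` is a Borel, locally bounded, nonnegative solution of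
`V_t f(x) = P_t f(x) - ∫_0^t ds ∫_E φ(y, V_s f) P_{t-s}(x,dy)`. -/
structure IsCumulantSemigroup {E : Type*} [MeasurableSpace E] (P : TransitionSemigroup E)
    (φ : BranchingMechanism E) (V : ℝ≥0 → (E → ℝ) → E → ℝ) : Prop where
  measurable : ∀ f, IsBoundedBorelNonneg f → Measurable (fun p : ℝ≥0 × E => V p.1 f p.2)
  nonneg : ∀ f, IsBoundedBorelNonneg f → ∀ t x, 0 ≤ V t f x
  locallyBounded : ∀ f, IsBoundedBorelNonneg f →
    ∀ T : ℝ≥0, ∃ C : ℝ, ∀ t ≤ T, ∀ x, V t f x ≤ C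
  equation : ∀ f, IsBoundedBorelNonneg f → ∀ (t : ℝ≥0) (x : E),
    V t f x = ∫ y, f y ∂(P.kernel t x)
      - ∫ s in (0 : ℝ)..t,
          ∫ y, φ.eval y (V s.toNNReal f) ∂(P.kernel ((t : ℝ) - s).toNNReal x)

/-- `(v_t)` is the cumulant semigroup of the CB-process with mechanism `φ`: for each `l ≥ 0`,
`t ↦ v_t(l)` is a nonnegative solution of `∂v_t(l)/∂t = -φ(v_t(l))`, `v_0(l) = l`
(the derivative at `t = 0` is one-sided). -/
structure IsCBCumulantSemigroup (φ : CBMechanism) (v : ℝ≥0 → ℝ → ℝ) : Prop where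
  nonneg : ∀ l, 0 ≤ l → ∀ t, 0 ≤ v t l
  initial : ∀ l, 0 ≤ l → v 0 l = l
  equation : ∀ l, 0 ≤ l → ∀ t : ℝ≥0,
    HasDerivWithinAt (fun s : ℝ => v s.toNNReal l) (-φ.eval (v t l)) (Set.Ici 0) t

end Superprocess

end

namespace Superprocess

/-! After adding a large linear killing term, the branching mechanism becomes order-preserving
enough to be compared with a scalar ODE. For a fixed bound `M` there is a `κ` with `φ₁(x,θ) ≤ φ(x,f)
+ κ(θ - f(x))` whenever `0 ≤ f ≤ θ ≤ M` (`exists_localProjection_le_eval_add`), so the domination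
hypothesis gives `κ f(x) - φ(x,f) ≤ κθ - φ_*(θ)`.

Killing at rate `κ` turns the mild equation into `V_t f = e^{-κt} P_t f + ∫_0^t e^{-κ(t-s)}
P_{t-s}(κ V_s f - φ(·,V_s f)) ds` (`mild_equation_shift`), and `v*` satisfies the same identity
without `P` (`equation_shift`). Since `P_t 1 ≤ 1`, the first right-hand side can be bounded term by
term by the second.

The comparison is iterated. The slope of `φ_*` is at least `b_*`, so a bound `V_s f ≤ v*_s + A(s)`
improves to `V_t f ≤ v*_t + ∫_0^t (κ + |b_*|) A(s) ds`. Starting from a constant `K`, the errors are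
`K (Lt)^n / n!` with `L = κ + |b_*|`, which tend to `0` (`le_of_mild_equation`). Working pointwise
in `x` avoids any question about measurability of `s ↦ ‖V_s f‖`.

The use of Fubini requires joint measurability: of `(t,x) ↦ P_t(x,·)`, from right continuity of
paths, and of `(s,x) ↦ φ(x,V_s f)`, from s-finiteness of `H`. -/

/-! ### S-finiteness of `H` and measurability of the mechanism. -/

/-- Weighting by `q` and normalising by `p` gives a finite kernel; dividing by the density `p q`
recovers `κ`. σ-finiteness of each `κ a` separately would not supply a decomposition measurable in
`a`. -/
theorem isSFiniteKernel_of_lintegral_lt_top {α β : Type*} [MeasurableSpace α] [MeasurableSpace β]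
    (κ : Kernel α β) {q : β → ℝ≥0∞} (hq : Measurable q) (hq0 : ∀ y, q y ≠ 0)
    (hqt : ∀ y, q y ≠ ∞) (hκ : ∀ a, ∫⁻ y, q y ∂(κ a) < ∞) : IsSFiniteKernel κ := by
  set p : α → ℝ≥0∞ := fun a => (1 + ∫⁻ y, q y ∂(κ a))⁻¹ with hp
  have hpm : Measurable p := (measurable_const.add hq.lintegral_kernel).inv
  have hp0 : ∀ a, p a ≠ 0 := fun a => by
    simpa [hp] using (hκ a).ne
  have hpt : ∀ a, p a ≠ ∞ := fun a => by
    simp [hp]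
  let κ' : Kernel α β :=
    { toFun := fun a => p a • (κ a).withDensity q
      measurable' := by
        refine Measure.measurable_of_measurable_coe _ fun s hs => ?_
        simp only [Measure.smul_apply, withDensity_apply _ hs, smul_eq_mul]
        simp_rw [← lintegral_indicator hs]
        exact hpm.mul (hq.indicator hs).lintegral_kernel }
  have hκ' : ∀ a, κ' a = p a • (κ a).withDensity q := fun _ => rfl
  have : IsFiniteKernel κ' := ⟨⟨1, ENNReal.one_lt_top, fun a => by
    simp only [hκ', Measure.smul_apply, withDensity_apply _ MeasurableSet.univ,
      Measure.restrict_univ, smul_eq_mul, hp]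
    rw [mul_comm, ← div_eq_mul_inv]
    exact ENNReal.div_le_of_le_mul (by rw [one_mul]; exact le_add_self)⟩⟩
  have hm : Measurable (Function.uncurry fun (a : α) (y : β) => (p a)⁻¹ * (q y)⁻¹) :=
    (hpm.comp measurable_fst).inv.mul (hq.comp measurable_snd).inv
  have hκeq : κ = κ'.withDensity fun a y => (p a)⁻¹ * (q y)⁻¹ := by
    ext1 a
    rw [Kernel.withDensity_apply _ hm, hκ', withDensity_smul_measure]
    have h1 : ((κ a).withDensity q).withDensity (fun y => (p a)⁻¹ * (q y)⁻¹)
        = (p a)⁻¹ • κ a := by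
      rw [show (fun y => (p a)⁻¹ * (q y)⁻¹) = (p a)⁻¹ • q⁻¹ from rfl,
        withDensity_smul _ hq.inv]
      congr 1
      exact withDensity_inv_same hq (ae_of_all _ hq0) (ae_of_all _ hqt)
    rw [h1, smul_smul, ENNReal.mul_inv_cancel (hp0 a) (hpt a), one_smul]
  rw [hκeq]
  exact Kernel.IsSFiniteKernel.withDensity _ fun a y =>
    ENNReal.mul_ne_top (ENNReal.inv_ne_top.2 (hp0 a)) (ENNReal.inv_ne_top.2 (hq0 y))

variable {E : Type*} [MeasurableSpace E]

/-- The tautological kernel `ν ↦ ν` from `M(E)°` to `E`. -/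
noncomputable def measKernel (E : Type*) [MeasurableSpace E] : Kernel (NonzeroMeasure E) E where
  toFun ν := ν.meas
  measurable' := measurable_subtype_coe.comp measurable_subtype_coe

theorem measKernel_apply (ν : NonzeroMeasure E) : measKernel E ν = ν.meas := rfl

instance : IsSFiniteKernel (measKernel E) :=
  isSFiniteKernel_of_lintegral_lt_top _ (q := 1) measurable_one (by simp) (by simp)
    fun ν => by simp [measKernel_apply]

theorem measurable_mass : Measurable fun ν : NonzeroMeasure E => ν.meas Set.univ :=
  (measKernel E).measurable_coe MeasurableSet.univ

theorem NonzeroMeasure.mass_ne_zero (ν : NonzeroMeasure E) : ν.meas Set.univ ≠ 0 := by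
  intro h
  apply ν.2
  apply Subtype.ext
  simpa using h

theorem BranchingMechanism.isSFiniteKernel_H (φ : BranchingMechanism E) :
    IsSFiniteKernel φ.H := by
  obtain ⟨C, hC⟩ := φ.bounded_H
  refine isSFiniteKernel_of_lintegral_lt_top φ.H
    -- This weight never vanishes because the zero measure is excluded from `M(E)°`.
    (q := fun ν => min (ν.meas Set.univ) (ν.meas Set.univ ^ 2))
    (measurable_mass.min (measurable_mass.pow_const 2)) (fun ν => ?_) (fun ν => ?_) fun x => ?_
  · have := ν.mass_ne_zero
    rw [← pos_iff_ne_zero] at this ⊢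
    exact lt_min this (ENNReal.pow_pos this 2)
  · exact ne_top_of_le_ne_top (measure_ne_top ν.meas Set.univ) (min_le_left _ _)
  · exact (lintegral_mono fun ν => le_self_add).trans_lt ((hC x).trans_lt ENNReal.coe_lt_top)

theorem measurable_integral_meas {α : Type*} [MeasurableSpace α] {g : α → E → ℝ}
    (hg : Measurable (Function.uncurry g)) :
    Measurable fun p : α × NonzeroMeasure E => ∫ y, g p.1 y ∂p.2.meas := by
  have := StronglyMeasurable.integral_kernel_prod_right
    (κ := (measKernel E).comap (Prod.snd : α × NonzeroMeasure E → _) measurable_snd)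
    (f := fun p y => g p.1 y)
    (hg.comp ((measurable_fst.comp measurable_fst).prodMk measurable_snd)).stronglyMeasurable
  exact this.measurable

theorem measurable_real_singleton [MeasurableEq E] :
    Measurable fun p : E × NonzeroMeasure E => p.2.meas.real {p.1} := by
  have h := Kernel.measurable_kernel_prodMk_left
    (κ := (measKernel E).comap (Prod.snd : E × NonzeroMeasure E → _) measurable_snd)
    (t := {p : (E × NonzeroMeasure E) × E | p.2 = p.1.1})
    (measurableSet_eq_fun measurable_snd (measurable_fst.comp measurable_fst))
  exact h.ennreal_toReal

theorem BranchingMechanism.measurable_eval [MeasurableEq E] (φ : BranchingMechanism E)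
    {α : Type*} [MeasurableSpace α] {u : α → E → ℝ} (hu : Measurable (Function.uncurry u)) :
    Measurable fun p : α × E => φ.eval p.2 (u p.1) := by
  have := φ.isSFiniteKernel_H
  have := φ.isFiniteKernel_η
  have hη : Measurable fun p : α × E => ∫ y, u p.1 y ∂(φ.η p.2) :=
    (StronglyMeasurable.integral_kernel_prod_right
      (κ := φ.η.comap (Prod.snd : α × E → _) measurable_snd) (f := fun p y => u p.1 y)
      (hu.comp ((measurable_fst.comp measurable_fst).prodMk
        measurable_snd)).stronglyMeasurable).measurable
  have hH : Measurable fun p : α × E =>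
      ∫ ν, (Real.exp (-∫ y, u p.1 y ∂ν.meas) - 1 + u p.1 p.2 * ν.meas.real {p.2})
        ∂(φ.H p.2) := by
    refine (StronglyMeasurable.integral_kernel_prod_right
      (κ := φ.H.comap (Prod.snd : α × E → _) measurable_snd)
      (f := fun p ν => Real.exp (-∫ y, u p.1 y ∂ν.meas) - 1 + u p.1 p.2 * ν.meas.real {p.2})
      (Measurable.stronglyMeasurable ?_)).measurable
    refine (((measurable_integral_meas hu).comp ((measurable_fst.comp measurable_fst).prodMk
      measurable_snd)).neg.exp.sub_const 1).add ((hu.comp measurable_fst).mul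
      (measurable_real_singleton.comp ((measurable_snd.comp measurable_fst).prodMk
        measurable_snd)))
  have hb : Measurable fun p : α × E => φ.b p.2 := φ.measurable_b.comp measurable_snd
  have hc : Measurable fun p : α × E => φ.c p.2 := φ.c_mem.measurable.comp measurable_snd
  have hu' : Measurable fun p : α × E => u p.1 p.2 := hu
  exact (((hb.mul hu').add (hc.mul (hu'.pow_const 2))).sub hη).add hH

/-! ### Elementary exponential inequalities. -/

theorem one_sub_exp_neg_le_mul_min {M r a : ℝ} (hM : 1 ≤ M) (ha : a ≤ M * r) :
    1 - Real.exp (-a) ≤ M * min 1 r := by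
  rcases le_total 1 r with h | h
  · rw [min_eq_left h]
    linarith [Real.exp_pos (-a)]
  · rw [min_eq_right h]
    linarith [Real.add_one_le_exp (-a)]

theorem min_sq_eq_mul_min {r : ℝ} (hr : 0 ≤ r) : min r (r ^ 2) = r * min 1 r := by
  rw [mul_min_of_nonneg _ _ hr, mul_one, sq]

theorem exp_neg_sub_one_add_nonneg (a : ℝ) : 0 ≤ Real.exp (-a) - 1 + a := by
  linarith [Real.add_one_le_exp (-a)]

theorem exp_neg_sub_one_add_le {M r a : ℝ} (hM : 1 ≤ M) (hr : 0 ≤ r) (h0 : 0 ≤ a)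
    (ha : a ≤ M * r) : Real.exp (-a) - 1 + a ≤ M ^ 2 * min r (r ^ 2) := by
  have h1 : Real.exp (-a) - 1 + a ≤ a * (1 - Real.exp (-a)) := by
    have := Real.add_one_le_exp a
    have h2 : Real.exp a * Real.exp (-a) = 1 := by rw [← Real.exp_add]; simp
    nlinarith [Real.exp_pos (-a)]
  have h2 := one_sub_exp_neg_le_mul_min hM ha
  have h3 : 0 ≤ 1 - Real.exp (-a) := by
    have : Real.exp (-a) ≤ 1 := Real.exp_le_one_iff.2 (by linarith)
    linarith
  calc _ ≤ a * (1 - Real.exp (-a)) := h1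
    _ ≤ (M * r) * (M * min 1 r) := by gcongr
    _ = _ := by rw [min_sq_eq_mul_min hr]; ring

/-- Lower bound for the increment of `z ↦ e^{-zp}` between `θ` and `y ≤ θ`. -/
theorem exp_neg_sub_exp_neg_ge {M r p y θ : ℝ} (hM : 1 ≤ M) (hp : 0 ≤ p) (hpr : p ≤ r)
    (hyθ : y ≤ θ) (hθ : 0 ≤ θ) (hθM : θ ≤ M) :
    (θ - y) * p - (θ - y) * M * min r (r ^ 2) ≤ Real.exp (-(y * p)) - Real.exp (-(θ * p)) := by
  -- Convexity: the tangent at `θ`. Its slope falls short of `p` by `p(1 - e^{-θp})`, which is of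
  -- order `r ∧ r²` and hence integrable against `H`, while `p` itself need not be.
  have h1 : Real.exp (-(θ * p)) * ((θ - y) * p + 1) ≤ Real.exp (-(y * p)) := by
    have h2 : Real.exp (-(y * p)) = Real.exp (-(θ * p)) * Real.exp ((θ - y) * p) := by
      rw [← Real.exp_add]; ring_nf
    rw [h2]
    gcongr
    exact Real.add_one_le_exp _
  have hr : 0 ≤ r := hp.trans hpr
  have h3 := one_sub_exp_neg_le_mul_min (r := r) (a := θ * p) hM (by gcongr)
  have h4 : p * (1 - Real.exp (-(θ * p))) ≤ r * (M * min 1 r) := by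
    gcongr
    have : Real.exp (-(θ * p)) ≤ 1 := Real.exp_le_one_iff.2 (by nlinarith)
    linarith
  have h5 := mul_le_mul_of_nonneg_left h4 (sub_nonneg.2 hyθ)
  rw [min_sq_eq_mul_min hr]
  nlinarith

/-! ### Bounds on the branching mechanism and its local projection. -/

section Mechanism

variable {E : Type*} [MeasurableSpace E]

/-- `ν(1) ∧ ν(1)² + ν_x(1)`. -/
noncomputable def weight (x : E) (ν : NonzeroMeasure E) : ℝ :=
  min (ν.meas.real Set.univ) (ν.meas.real Set.univ ^ 2) + ν.meas.real {x}ᶜ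

theorem ofReal_weight (x : E) (ν : NonzeroMeasure E) :
    ENNReal.ofReal (weight x ν)
      = min (ν.meas Set.univ) (ν.meas Set.univ ^ 2) + ν.meas {x}ᶜ := by
  rw [weight, ENNReal.ofReal_add (by positivity) (by positivity), ofReal_measureReal,
    ENNReal.ofReal_min, ENNReal.ofReal_pow (by positivity), ofReal_measureReal]

theorem weight_nonneg (x : E) (ν : NonzeroMeasure E) : 0 ≤ weight x ν := by
  unfold weight; positivity

theorem measurable_real_set {s : Set E} (hs : MeasurableSet s) :
    Measurable fun ν : NonzeroMeasure E => ν.meas.real s :=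
  ((measKernel E).measurable_coe hs).ennreal_toReal

theorem integrable_of_bounded {f : E → ℝ} (hf : Measurable f) {M : ℝ} (h0 : ∀ y, 0 ≤ f y)
    (hM : ∀ y, f y ≤ M) (μ : Measure E) [IsFiniteMeasure μ] : Integrable f μ :=
  Integrable.of_bound hf.aestronglyMeasurable M
    (ae_of_all _ fun y => by rw [Real.norm_of_nonneg (h0 y)]; exact hM y)

theorem setIntegral_le_mul {f : E → ℝ} (hf : Measurable f) {M : ℝ} (h0 : ∀ y, 0 ≤ f y)
    (hM : ∀ y, f y ≤ M) (μ : Measure E) [IsFiniteMeasure μ] (s : Set E) :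
    ∫ y in s, f y ∂μ ≤ M * μ.real s := by
  calc ∫ y in s, f y ∂μ ≤ ∫ _ in s, M ∂μ :=
        integral_mono (integrable_of_bounded hf h0 hM _) (integrable_const _) hM
    _ = M * μ.real s := by simp [mul_comm]

theorem BranchingMechanism.exists_eta_le (φ : BranchingMechanism E) : ∃ C : ℝ, 0 ≤ C ∧ ∀ x, (φ.η x).real Set.univ ≤ C := by
  obtain ⟨C, hC, h⟩ := φ.isFiniteKernel_η.exists_univ_le
  exact ⟨C.toReal, ENNReal.toReal_nonneg, fun x => ENNReal.toReal_mono hC.ne (h x)⟩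

variable [MeasurableSingletonClass E]

theorem measurable_weight (x : E) : Measurable (weight x) := by
  have h := measurable_real_set (E := E) MeasurableSet.univ
  exact (h.min (h.pow_const 2)).add (measurable_real_set (measurableSet_singleton x).compl)

namespace BranchingMechanism

variable (φ : BranchingMechanism E)

theorem integrable_weight (x : E) : Integrable (weight x) (φ.H x) := by
  obtain ⟨C, hC⟩ := φ.bounded_H
  refine (lintegral_ofReal_ne_top_iff_integrable (measurable_weight x).aestronglyMeasurable
    (ae_of_all _ (weight_nonneg x))).1 ?_
  simp_rw [ofReal_weight]
  exact ((hC x).trans_lt ENNReal.coe_lt_top).ne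

theorem exists_integral_weight_le : ∃ C : ℝ, 0 ≤ C ∧ ∀ x, ∫ ν, weight x ν ∂(φ.H x) ≤ C := by
  obtain ⟨C, hC⟩ := φ.bounded_H
  refine ⟨C, C.2, fun x => ?_⟩
  rw [integral_eq_lintegral_of_nonneg_ae (ae_of_all _ (weight_nonneg x))
    (measurable_weight x).aestronglyMeasurable]
  simp_rw [ofReal_weight]
  exact ENNReal.toReal_le_of_le_ofReal C.2 (by simpa using hC x)

end BranchingMechanism

theorem integral_eq_singleton_add {f : E → ℝ} {μ : Measure E} [IsFiniteMeasure μ]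
    (hf : Integrable f μ) (x : E) :
    ∫ y, f y ∂μ = f x * μ.real {x} + ∫ y in {x}ᶜ, f y ∂μ := by
  rw [← integral_add_compl (measurableSet_singleton x) hf, integral_singleton, smul_eq_mul,
    mul_comm]

theorem real_singleton_add_compl (μ : Measure E) [IsFiniteMeasure μ] (x : E) :
    μ.real {x} + μ.real {x}ᶜ = μ.real Set.univ :=
  measureReal_add_measureReal_compl (measurableSet_singleton x)

namespace BranchingMechanism

variable (φ : BranchingMechanism E)

/-- With `I = ν(f)`, the integrand is `(e^{-I} - 1 + I)` minus the integral of `f` off `x`. The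
first part is controlled by `ν(1) ∧ ν(1)²`, the second by `ν_x(1)`. -/
theorem abs_eval_integrand_le {f : E → ℝ} (hf : Measurable f) {M : ℝ} (hM1 : 1 ≤ M)
    (h0 : ∀ y, 0 ≤ f y) (hM : ∀ y, f y ≤ M) (x : E) (ν : NonzeroMeasure E) :
    |Real.exp (-∫ y, f y ∂ν.meas) - 1 + f x * ν.meas.real {x}| ≤ 2 * M ^ 2 * weight x ν := by
  have h1 := integral_eq_singleton_add (integrable_of_bounded hf h0 hM ν.meas) x
  have h2 := setIntegral_le_mul hf h0 hM ν.meas {x}ᶜ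
  have h3 := setIntegral_le_mul hf h0 hM ν.meas Set.univ
  rw [Measure.restrict_univ] at h3
  have h4 : 0 ≤ ∫ y, f y ∂ν.meas := integral_nonneg h0
  have h5 : 0 ≤ ∫ y in {x}ᶜ, f y ∂ν.meas := integral_nonneg h0
  set I := ∫ y, f y ∂ν.meas
  have h6 := exp_neg_sub_one_add_nonneg I
  have h7 := exp_neg_sub_one_add_le hM1 (measureReal_nonneg (μ := ν.meas)) h4 h3
  have hq : 0 ≤ ν.meas.real {x}ᶜ := measureReal_nonneg
  have hm : 0 ≤ min (ν.meas.real Set.univ) (ν.meas.real Set.univ ^ 2) := by positivity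
  have h8 : M * ν.meas.real {x}ᶜ ≤ M ^ 2 * ν.meas.real {x}ᶜ := by
    gcongr; nlinarith
  unfold weight
  set m := min (ν.meas.real Set.univ) (ν.meas.real Set.univ ^ 2)
  have h9 : 0 ≤ M ^ 2 * m := by positivity
  have h10 : 0 ≤ M ^ 2 * ν.meas.real {x}ᶜ := by positivity
  rw [abs_le]
  constructor <;> nlinarith

theorem integrable_eval_integrand {f : E → ℝ} (hf : Measurable f) {M : ℝ} (hM1 : 1 ≤ M)
    (h0 : ∀ y, 0 ≤ f y) (hM : ∀ y, f y ≤ M) (x : E) :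
    Integrable (fun ν : NonzeroMeasure E =>
      Real.exp (-∫ y, f y ∂ν.meas) - 1 + f x * ν.meas.real {x}) (φ.H x) := by
  refine ((φ.integrable_weight x).const_mul (2 * M ^ 2)).mono' ?_
    (ae_of_all _ (abs_eval_integrand_le hf hM1 h0 hM x))
  have h1 : Measurable fun ν : NonzeroMeasure E => ∫ y, f y ∂ν.meas :=
    (measurable_integral_meas (g := fun _ : Unit => f) (hf.comp measurable_snd)).comp
      (measurable_const.prodMk measurable_id : Measurable fun ν => ((), ν))
  exact ((h1.neg.exp.sub_const 1).add
    ((measurable_real_set (measurableSet_singleton x)).const_mul _)).aestronglyMeasurable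

theorem integrable_real_compl (x : E) :
    Integrable (fun ν : NonzeroMeasure E => ν.meas.real {x}ᶜ) (φ.H x) := by
  refine (φ.integrable_weight x).mono'
    (measurable_real_set (measurableSet_singleton x).compl).aestronglyMeasurable
    (ae_of_all _ fun ν => ?_)
  rw [Real.norm_of_nonneg measureReal_nonneg, weight]
  have : 0 ≤ min (ν.meas.real Set.univ) (ν.meas.real Set.univ ^ 2) := by positivity
  linarith

theorem integrable_localProjection_integrand (x : E) {θ : ℝ} (hθ : 0 ≤ θ) :
    Integrable (fun ν : NonzeroMeasure E =>
      Real.exp (-(θ * ν.meas.real {x})) - 1 + θ * ν.meas.real {x}) (φ.H x) := by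
  refine ((φ.integrable_weight x).const_mul ((1 + θ) ^ 2)).mono' ?_ (ae_of_all _ fun ν => ?_)
  · have := (measurable_real_set (measurableSet_singleton x)).const_mul θ
    exact ((this.neg.exp.sub_const 1).add this).aestronglyMeasurable
  · have hp : 0 ≤ ν.meas.real {x} := measureReal_nonneg
    have hq : 0 ≤ ν.meas.real {x}ᶜ := measureReal_nonneg
    have hr := real_singleton_add_compl ν.meas x
    have h := exp_neg_sub_one_add_le (M := 1 + θ) (r := ν.meas.real Set.univ)
      (a := θ * ν.meas.real {x}) (by linarith) measureReal_nonneg (by positivity) (by nlinarith)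
    rw [Real.norm_of_nonneg (exp_neg_sub_one_add_nonneg _), weight]
    nlinarith [sq_nonneg (1 + θ)]

theorem exists_abs_eval_le {M : ℝ} (hM1 : 1 ≤ M) :
    ∃ B : ℝ, 0 ≤ B ∧ ∀ (x : E) (f : E → ℝ), Measurable f → (∀ y, 0 ≤ f y) → (∀ y, f y ≤ M) →
      |φ.eval x f| ≤ B := by
  obtain ⟨Cb, hCb⟩ := φ.bounded_b
  obtain ⟨Cc, hCc⟩ := φ.c_mem.bounded
  obtain ⟨Ce, hCe0, hCe⟩ := φ.exists_eta_le
  obtain ⟨Cw, hCw0, hCw⟩ := φ.exists_integral_weight_le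
  have := φ.isFiniteKernel_η
  have key : ∀ (x : E) (f : E → ℝ), Measurable f → (∀ y, 0 ≤ f y) → (∀ y, f y ≤ M) →
      |φ.eval x f| ≤ Cb * M + Cc * M ^ 2 + M * Ce + 2 * M ^ 2 * Cw := by
    intro x f hf h0 hM
    have h1 : |φ.b x * f x| ≤ Cb * M := by
      rw [abs_mul, abs_of_nonneg (h0 x)]
      exact mul_le_mul (hCb x) (hM x) (h0 x) ((abs_nonneg _).trans (hCb x))
    have h2 : |φ.c x * f x ^ 2| ≤ Cc * M ^ 2 := by
      have := φ.c_mem.nonneg x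
      rw [abs_of_nonneg (by positivity)]
      exact mul_le_mul (hCc x) (pow_le_pow_left₀ (h0 x) (hM x) 2) (by positivity)
        (this.trans (hCc x))
    have h3 : |∫ y, f y ∂(φ.η x)| ≤ M * Ce := by
      rw [abs_of_nonneg (integral_nonneg h0)]
      have h := setIntegral_le_mul hf h0 hM (φ.η x) Set.univ
      rw [Measure.restrict_univ] at h
      exact h.trans (by gcongr; exact hCe x)
    have h4 : |∫ ν, (Real.exp (-∫ y, f y ∂ν.meas) - 1 + f x * ν.meas.real {x}) ∂(φ.H x)|
        ≤ 2 * M ^ 2 * Cw := by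
      calc _ ≤ ∫ ν, |Real.exp (-∫ y, f y ∂ν.meas) - 1 + f x * ν.meas.real {x}| ∂(φ.H x) :=
            abs_integral_le_integral_abs
        _ ≤ ∫ ν, 2 * M ^ 2 * weight x ν ∂(φ.H x) :=
            integral_mono (φ.integrable_eval_integrand hf hM1 h0 hM x).abs
              ((φ.integrable_weight x).const_mul _) (abs_eval_integrand_le hf hM1 h0 hM x)
        _ = 2 * M ^ 2 * ∫ ν, weight x ν ∂(φ.H x) := integral_const_mul _ _
        _ ≤ _ := by gcongr; exact hCw x
    unfold eval
    rw [abs_le] at *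
    constructor <;> linarith [h1.1, h1.2, h2.1, h2.2, h3.1, h3.2, h4.1, h4.2]
  -- The maximum with `0` covers empty `E`, where the constants chosen for `b` and `c` may be
  -- negative.
  exact ⟨max 0 _, le_max_left _ _, fun x f hf h0 hM =>
    (key x f hf h0 hM).trans (le_max_right _ _)⟩

/-- Replacing `f` by `θ` away from `x` changes the nonlocal terms by at most `θ γ(x,1)`, which is
exactly what `φ₁` subtracts. Replacing `f(x)` by `θ` costs a Lipschitz term, absorbed by `κ`. -/
theorem exists_localProjection_le_eval_add {M : ℝ} (hM1 : 1 ≤ M) :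
    ∃ κ : ℝ, 0 ≤ κ ∧ ∀ (x : E) (f : E → ℝ) (θ : ℝ), Measurable f → (∀ y, 0 ≤ f y) →
      (∀ y, f y ≤ θ) → θ ≤ M → φ.localProjection x θ ≤ φ.eval x f + κ * (θ - f x) := by
  obtain ⟨Cb, hCb⟩ := φ.bounded_b
  obtain ⟨Cc, hCc⟩ := φ.c_mem.bounded
  obtain ⟨Cw, hCw0, hCw⟩ := φ.exists_integral_weight_le
  have := φ.isFiniteKernel_η
  have key : ∀ (x : E) (f : E → ℝ) (θ : ℝ), Measurable f → (∀ y, 0 ≤ f y) →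
      (∀ y, f y ≤ θ) → θ ≤ M →
      φ.localProjection x θ ≤ φ.eval x f + (Cb + 2 * M * Cc + M * Cw) * (θ - f x) := by
    intro x f θ hf h0 hθ hθM
    have ha : 0 ≤ θ - f x := sub_nonneg.2 (hθ x)
    have hθ0 : 0 ≤ θ := (h0 x).trans (hθ x)
    have h1 : φ.b x * (θ - f x) ≤ Cb * (θ - f x) := by
      gcongr; exact (le_abs_self _).trans (hCb x)
    have h2 : φ.c x * (θ ^ 2 - f x ^ 2) ≤ 2 * M * Cc * (θ - f x) := by
      have h : θ ^ 2 - f x ^ 2 = (θ + f x) * (θ - f x) := by ring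
      have h' : φ.c x * (θ + f x) ≤ Cc * (2 * M) :=
        mul_le_mul (hCc x) (by linarith [hθ x]) (by linarith [h0 x])
          ((φ.c_mem.nonneg x).trans (hCc x))
      rw [h]
      nlinarith
    have h3 : ∫ y, f y ∂(φ.η x) ≤ θ * (φ.η x).real Set.univ := by
      have h := setIntegral_le_mul hf h0 hθ (φ.η x) Set.univ
      rwa [Measure.restrict_univ] at h
    have h4 : ∫ ν, (Real.exp (-(θ * ν.meas.real {x})) - 1 + θ * ν.meas.real {x}) ∂(φ.H x)
        ≤ ∫ ν, (Real.exp (-∫ y, f y ∂ν.meas) - 1 + f x * ν.meas.real {x}) ∂(φ.H x)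
          + θ * ∫ ν, ν.meas.real {x}ᶜ ∂(φ.H x)
          + (θ - f x) * M * ∫ ν, weight x ν ∂(φ.H x) := by
      have hi := φ.integrable_eval_integrand hf hM1 h0 (fun y => (hθ y).trans hθM) x
      have hj := (φ.integrable_real_compl x).const_mul θ
      have hw := (φ.integrable_weight x).const_mul ((θ - f x) * M)
      rw [← integral_const_mul, ← integral_const_mul, ← integral_add hi hj]
      refine le_of_le_of_eq (integral_mono (φ.integrable_localProjection_integrand x hθ0)
        ((hi.add hj).add hw) fun ν => ?_) (integral_add (hi.add hj) hw)
      have e1 := integral_eq_singleton_add (integrable_of_bounded hf h0 hθ ν.meas) x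
      have e2 := setIntegral_le_mul hf h0 hθ ν.meas {x}ᶜ
      have hp : 0 ≤ ν.meas.real {x} := measureReal_nonneg
      have hq : 0 ≤ ν.meas.real {x}ᶜ := measureReal_nonneg
      have hr := real_singleton_add_compl ν.meas x
      have e3 := exp_neg_sub_exp_neg_ge (r := ν.meas.real Set.univ) hM1 hp (by linarith)
        (hθ x) hθ0 hθM
      -- Off-site part: `e^{-p-q} ≥ e^{-p}(1 - q) ≥ e^{-p} - q`. Together with the on-site increment
      -- `e3` it gives the pointwise inequality.
      have e4 : Real.exp (-(f x * ν.meas.real {x})) - θ * ν.meas.real {x}ᶜ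
          ≤ Real.exp (-∫ y, f y ∂ν.meas) := by
        set p := f x * ν.meas.real {x}
        set q := θ * ν.meas.real {x}ᶜ with hq_def
        have hp' : 0 ≤ p := mul_nonneg (h0 x) hp
        have hq' : 0 ≤ q := mul_nonneg hθ0 hq
        have g1 : Real.exp (-p + -q) ≤ Real.exp (-∫ y, f y ∂ν.meas) :=
          Real.exp_le_exp.2 (by linarith)
        rw [Real.exp_add] at g1
        have g2 := Real.add_one_le_exp (-q)
        have g3 : Real.exp (-p) ≤ 1 := Real.exp_le_one_iff.2 (by linarith)
        nlinarith [Real.exp_pos (-p)]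
      have e5 : (θ - f x) * M * min (ν.meas.real Set.univ) (ν.meas.real Set.univ ^ 2)
          ≤ (θ - f x) * M * weight x ν := by
        have : 0 ≤ (θ - f x) * M := by nlinarith
        gcongr
        unfold weight; linarith
      simp only [Pi.add_apply]
      linarith
    have h5 : (θ - f x) * M * ∫ ν, weight x ν ∂(φ.H x) ≤ (θ - f x) * M * Cw := by
      gcongr; exact hCw x
    unfold localProjection eval gammaMass
    linarith
  refine ⟨max 0 (Cb + 2 * M * Cc + M * Cw), le_max_left _ _,
    fun x f θ hf h0 hθ hθM => (key x f θ hf h0 hθ hθM).trans ?_⟩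
  gcongr
  · exact sub_nonneg.2 (hθ x)
  · exact le_max_right _ _

end BranchingMechanism

end Mechanism

/-! ### Joint measurability of the transition kernels in time and space. -/

section RightContinuity

/-- The smallest multiple of `1 / (n + 1)` that is larger than `t`. -/
noncomputable def gridAbove (n : ℕ) (t : ℝ≥0) : ℝ≥0 := (⌊(n + 1 : ℝ≥0) * t⌋₊ + 1) / (n + 1)

theorem le_gridAbove (n : ℕ) (t : ℝ≥0) : t ≤ gridAbove n t := by
  rw [gridAbove, le_div_iff₀ (by positivity), mul_comm]
  exact (Nat.lt_floor_add_one _).le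

theorem gridAbove_le (n : ℕ) (t : ℝ≥0) : gridAbove n t ≤ t + 1 / (n + 1) := by
  rw [gridAbove, add_div, ← mul_div_cancel_left₀ t (show (n + 1 : ℝ≥0) ≠ 0 by positivity)]
  gcongr
  rw [mul_div_cancel_left₀ t (show (n + 1 : ℝ≥0) ≠ 0 by positivity)]
  exact Nat.floor_le zero_le

theorem tendsto_gridAbove (t : ℝ≥0) :
    Tendsto (fun n => gridAbove n t) atTop (𝓝[Set.Ici t] t) := by
  refine tendsto_nhdsWithin_iff.2 ⟨?_, Eventually.of_forall fun n => le_gridAbove n t⟩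
  refine tendsto_of_tendsto_of_tendsto_of_le_of_le tendsto_const_nhds ?_
    (fun n => le_gridAbove n t) (fun n => gridAbove_le n t)
  simpa using tendsto_const_nhds.add (tendsto_one_div_add_atTop_nhds_zero_nat (𝕜 := ℝ≥0))

/-- The grid has countably many points, so measurability at each fixed time suffices. -/
theorem measurable_comp_gridAbove {α : Type*} [MeasurableSpace α]
    {F : ℝ≥0 → α → ℝ≥0∞} (hF : ∀ t, Measurable (F t)) (n : ℕ) :
    Measurable fun p : ℝ≥0 × α => F (gridAbove n p.1) p.2 := by
  obtain ⟨G, hG⟩ : ∃ G : ℕ → ℝ≥0, ∀ k : ℕ, ((k : ℝ≥0) + 1) / (n + 1) = G k := ⟨_, fun _ => rfl⟩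
  simp only [gridAbove, hG]
  have h : Measurable fun q : ℕ × α => F (G q.1) q.2 :=
    measurable_from_prod_countable_right fun k => hF (G k)
  obtain ⟨c, hc⟩ : ∃ c : ℝ≥0, c = n + 1 := ⟨_, rfl⟩
  rw [← hc]
  have hfl : Measurable fun p : ℝ≥0 × α => ⌊c * p.1⌋₊ :=
    (measurable_const.mul measurable_fst).nat_floor
  exact h.comp (hfl.prodMk measurable_snd)

theorem measurable_uncurry_of_tendsto_gridAbove {α : Type*} [MeasurableSpace α]
    {F : ℝ≥0 → α → ℝ≥0∞} (hF : ∀ t, Measurable (F t))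
    (hlim : ∀ t y, Tendsto (fun n => F (gridAbove n t) y) atTop (𝓝 (F t y))) :
    Measurable (Function.uncurry F) :=
  measurable_of_tendsto_metrizable (measurable_comp_gridAbove hF)
    (tendsto_pi_nhds.2 fun p => hlim p.1 p.2)

end RightContinuity

section Transition

variable {E : Type*} [TopologicalSpace E] [MeasurableSpace E] {P : TransitionSemigroup E}
  {Ω : Type*} [MeasurableSpace Ω]

omit [TopologicalSpace E] in
theorem measurable_extendZero {h : E → ℝ≥0∞} (hh : Measurable h) : Measurable (extendZero h) :=
  measurable_fun_sum hh measurable_const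

theorem BorelRightProcess.measurable_path (ξ : BorelRightProcess P Ω) (t : ℝ≥0) :
    Measurable (ξ.path t) := (ξ.adapted t).mono (ξ.filtration.le t) le_rfl

/-- The Markov property at time `0`, where the process sits at `x`. -/
theorem BorelRightProcess.law_preimage_inl (ξ : BorelRightProcess P Ω) (t : ℝ≥0) (x : E)
    {B : Set E} (hB : MeasurableSet B) :
    ξ.law x (ξ.path t ⁻¹' (Sum.inl '' B)) = P.kernel t x B := by
  have := ξ.isProbabilityMeasure_law x
  have h := ξ.markov x 0 t Set.univ MeasurableSet.univ B hB
  rw [Set.univ_inter, zero_add, Measure.restrict_univ] at h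
  rw [h, lintegral_congr_ae (g := fun _ => P.kernel t x B)]
  · simp
  · filter_upwards [ξ.initial x] with ω hω
    simp [hω, extendZero]

theorem BorelRightProcess.restrict_map_path (ξ : BorelRightProcess P Ω) (t : ℝ≥0) (x : E) :
    ((ξ.law x).map (ξ.path t)).restrict (Set.range Sum.inl) = (P.kernel t x).map Sum.inl := by
  ext s hs
  have hpre : MeasurableSet ((Sum.inl : E → E ⊕ Unit) ⁻¹' s) := measurable_inl hs
  rw [Measure.restrict_apply hs, Measure.map_apply measurable_inl hs,
    ← Set.image_preimage_eq_inter_range,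
    Measure.map_apply (ξ.measurable_path t) hpre.inl_image, ξ.law_preimage_inl t x hpre]

theorem BorelRightProcess.lintegral_extendZero (ξ : BorelRightProcess P Ω) (t : ℝ≥0) (x : E)
    {h : E → ℝ≥0∞} (hh : Measurable h) :
    ∫⁻ ω, extendZero h (ξ.path t ω) ∂(ξ.law x) = ∫⁻ y, h y ∂(P.kernel t x) := by
  have hm := measurable_extendZero hh
  have hi : (Set.range (Sum.inl : E → E ⊕ Unit)).indicator (extendZero h) = extendZero h := by
    refine Set.indicator_eq_self.2 fun z hz => ?_
    cases z with
    | inl y => exact ⟨y, rfl⟩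
    | inr y => exact absurd rfl hz
  rw [← lintegral_map hm (ξ.measurable_path t), ← hi, lintegral_indicator measurableSet_range_inl,
    ξ.restrict_map_path, lintegral_map hm measurable_inl]
  rfl

/-- Right-continuous paths and dominated convergence make `t ↦ P_t h(x)` right continuous for
bounded continuous `h`, so grid sampling gives joint measurability. Closed sets follow by outer
approximation, Borel sets by a π-system argument. -/
theorem BorelRightProcess.measurable_kernel [BorelSpace E] [HasOuterApproxClosed E]
    (ξ : BorelRightProcess P Ω) : Measurable fun p : ℝ≥0 × E => P.kernel p.1 p.2 := by
  have hfin : ∀ p : ℝ≥0 × E, IsFiniteMeasure (P.kernel p.1 p.2) := fun p =>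
    ⟨(P.mass_le_one p.1 p.2).trans_lt ENNReal.one_lt_top⟩
  have hcont : ∀ h : BoundedContinuousFunction E ℝ≥0,
      Measurable fun p : ℝ≥0 × E => ∫⁻ y, h y ∂(P.kernel p.1 p.2) := by
    intro h
    have hm : Measurable fun y => (h y : ℝ≥0∞) := h.continuous.measurable.coe_nnreal_ennreal
    have hc : Continuous (extendZero fun y => (h y : ℝ≥0∞)) :=
      (ENNReal.continuous_coe.comp h.continuous).sumElim continuous_const
    have hbd : ∀ z, extendZero (fun y => (h y : ℝ≥0∞)) z ≤ (nndist h 0 : ℝ≥0∞) := by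
      rintro (y | y)
      · exact ENNReal.coe_le_coe.2 (BoundedContinuousFunction.NNReal.upper_bound h y)
      · exact zero_le
    refine measurable_uncurry_of_tendsto_gridAbove
      (F := fun t x => ∫⁻ y, h y ∂(P.kernel t x)) (fun t => hm.lintegral_kernel) fun t x => ?_
    have := ξ.isProbabilityMeasure_law x
    simp_rw [← ξ.lintegral_extendZero _ x hm]
    refine tendsto_lintegral_of_dominated_convergence (fun _ => (nndist h 0 : ℝ≥0∞))
      (fun n => (measurable_extendZero hm).comp (ξ.measurable_path _))
      (fun n => ae_of_all _ fun ω => ?_) (by simp) (ae_of_all _ fun ω => ?_)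
    · exact hbd _
    · exact (hc.continuousAt.tendsto.comp (ξ.rightContinuous ω t)).comp (tendsto_gridAbove t)
  have hclosed : ∀ F : Set E, IsClosed F →
      Measurable fun p : ℝ≥0 × E => P.kernel p.1 p.2 F := fun F hF =>
    measurable_of_tendsto_metrizable (fun n => hcont (hF.apprSeq n))
      (tendsto_pi_nhds.2 fun p =>
        HasOuterApproxClosed.tendsto_lintegral_apprSeq hF (P.kernel p.1 p.2))
  refine Measurable.measure_of_isPiSystem (S := {s | IsClosed s}) ?_ isPiSystem_isClosed
    hclosed (hclosed _ isClosed_univ)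
  rw [BorelSpace.measurable_eq (α := E), borel_eq_generateFrom_isClosed]

end Transition

/-! ### Shifting the mild equation by a killing rate. -/

section MildEquation

variable {E : Type*} [MeasurableSpace E]

namespace TransitionSemigroup

variable (P : TransitionSemigroup E)

instance (t : ℝ≥0) (x : E) : IsFiniteMeasure (P.kernel t x) :=
  ⟨(P.mass_le_one t x).trans_lt ENNReal.one_lt_top⟩

theorem real_univ_le_one (t : ℝ≥0) (x : E) : (P.kernel t x).real Set.univ ≤ 1 := by
  simpa [Measure.real] using ENNReal.toReal_mono ENNReal.one_ne_top (P.mass_le_one t x)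

instance (t : ℝ≥0) : IsFiniteKernel (P.kernel t) :=
  ⟨⟨1, ENNReal.one_lt_top, P.mass_le_one t⟩⟩

theorem integrable_of_abs_le {g : E → ℝ} (hg : Measurable g) {B : ℝ} (hB : ∀ y, |g y| ≤ B)
    (t : ℝ≥0) (x : E) : Integrable g (P.kernel t x) :=
  Integrable.of_bound hg.aestronglyMeasurable B (ae_of_all _ hB)

theorem abs_integral_le {g : E → ℝ} {B : ℝ} (hB0 : 0 ≤ B) (hB : ∀ y, |g y| ≤ B)
    (t : ℝ≥0) (x : E) : |∫ y, g y ∂(P.kernel t x)| ≤ B :=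
  calc |∫ y, g y ∂(P.kernel t x)| ≤ B * (P.kernel t x).real Set.univ :=
        norm_integral_le_of_norm_le_const (μ := P.kernel t x) (f := g) (ae_of_all _ hB)
    _ ≤ B * 1 := by gcongr; exact P.real_univ_le_one t x
    _ = B := mul_one B

theorem integral_le {g : E → ℝ} (hg : Measurable g) {B D : ℝ} (hB : ∀ y, |g y| ≤ B)
    (hD0 : 0 ≤ D) (hD : ∀ y, g y ≤ D) (t : ℝ≥0) (x : E) : ∫ y, g y ∂(P.kernel t x) ≤ D :=
  calc ∫ y, g y ∂(P.kernel t x) ≤ ∫ _, D ∂(P.kernel t x) :=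
        integral_mono (P.integrable_of_abs_le hg hB t x) (integrable_const _) hD
    _ = D * (P.kernel t x).real Set.univ := by simp [mul_comm]
    _ ≤ D * 1 := by gcongr; exact P.real_univ_le_one t x
    _ = D := mul_one D

theorem integral_integral {g : E → ℝ} (hg : Measurable g) {B : ℝ} (hB : ∀ y, |g y| ≤ B)
    (s t : ℝ≥0) (x : E) :
    ∫ y, ∫ z, g z ∂(P.kernel t y) ∂(P.kernel s x) = ∫ z, g z ∂(P.kernel (s + t) x) := by
  have h : P.kernel (s + t) x = (P.kernel t ∘ₖ P.kernel s) x := by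
    ext A hA
    rw [P.add s t x A hA, Kernel.comp_apply' _ _ _ hA]
  rw [h, Kernel.integral_comp]
  rw [← h]
  exact P.integrable_of_abs_le hg hB _ x

end TransitionSemigroup

theorem _root_.Real.hasDerivAt_exp_neg_mul_sub (κ t s : ℝ) :
    HasDerivAt (fun s => Real.exp (-(κ * (t - s)))) (Real.exp (-(κ * (t - s))) * κ) s := by
  have h : HasDerivAt (fun s => -(κ * (t - s))) κ s := by
    simpa using! (((hasDerivAt_id s).const_sub t).const_mul κ).neg
  exact h.exp

/-- Integrating factor for a function of the form `s ↦ p - ∫_0^s F`. -/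
theorem integral_exp_mul_integratingFactor {F : ℝ → ℝ} {t : ℝ}
    (hF : IntervalIntegrable F volume 0 t) (κ p : ℝ) :
    ∫ s in (0 : ℝ)..t, Real.exp (-(κ * (t - s))) * (κ * (p - ∫ r in (0 : ℝ)..s, F r) - F s)
      = (p - ∫ r in (0 : ℝ)..t, F r) - Real.exp (-(κ * t)) * p := by
  -- `F` is merely integrable, so its primitive is differentiable only almost everywhere; absolute
  -- continuity is what justifies integrating the derivative of the product.
  have hac1 : AbsolutelyContinuousOnInterval (fun s => Real.exp (-(κ * (t - s)))) 0 t := by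
    refine ContDiffOn.absolutelyContinuousOnInterval (ContDiff.contDiffOn ?_)
    fun_prop
  have hac2 : AbsolutelyContinuousOnInterval (fun s => p - ∫ r in (0 : ℝ)..s, F r) 0 t := by
    refine AbsolutelyContinuousOnInterval.sub (f := fun _ => p)
      (ContDiffOn.absolutelyContinuousOnInterval contDiffOn_const) ?_
    exact hF.absolutelyContinuousOnInterval_intervalIntegral (by simp)
  have key := (hac1.fun_mul hac2).integral_deriv_eq_sub
  simp only [sub_self, mul_zero, neg_zero, Real.exp_zero, one_mul, sub_zero,
    intervalIntegral.integral_same] at key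
  rw [← key]
  refine intervalIntegral.integral_congr_ae ?_
  filter_upwards [hF.ae_hasDerivAt_integral] with s hs hmem
  have h1 := hs (Set.uIoc_subset_uIcc hmem) 0 (by simp)
  rw [HasDerivAt.deriv (f := fun i => Real.exp (-(κ * (t - i))) * (p - ∫ r in (0 : ℝ)..i, F r))
    ((Real.hasDerivAt_exp_neg_mul_sub κ t s).mul (h1.const_sub p))]
  ring

variable {P : TransitionSemigroup E}

theorem measurable_integral_kernel (hP : Measurable fun p : ℝ≥0 × E => P.kernel p.1 p.2)
    {g : ℝ → E → ℝ} (hg : Measurable (Function.uncurry g)) :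
    Measurable fun q : ℝ × ℝ × E => ∫ y, g q.1 y ∂(P.kernel q.2.1.toNNReal q.2.2) := by
  let Q : Kernel (ℝ × ℝ × E) E := ⟨fun q => P.kernel q.2.1.toNNReal q.2.2,
    hP.comp ((measurable_real_toNNReal.comp (measurable_fst.comp measurable_snd)).prodMk
      (measurable_snd.comp measurable_snd))⟩
  have : IsFiniteKernel Q := ⟨⟨1, ENNReal.one_lt_top, fun q => P.mass_le_one _ _⟩⟩
  exact (StronglyMeasurable.integral_kernel_prod_right (κ := Q) (f := fun q y => g q.1 y)
    (hg.comp ((measurable_fst.comp measurable_fst).prodMk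
      measurable_snd)).stronglyMeasurable).measurable

theorem intervalIntegrable_of_abs_le {F : ℝ → ℝ} (hF : Measurable F) {B : ℝ}
    (hB : ∀ s, |F s| ≤ B) (a b : ℝ) : IntervalIntegrable F volume a b :=
  (intervalIntegrable_const (c := B)).mono_fun hF.aestronglyMeasurable
    (ae_of_all _ fun s => (hB s).trans (le_abs_self B))

/-- Fubini, then Chapman–Kolmogorov: `P_{t-s} P_{s-r} = P_{t-r}`. -/
theorem integral_integral_mild (hP : Measurable fun p : ℝ≥0 × E => P.kernel p.1 p.2)
    {Φ : ℝ → E → ℝ} (hΦ : Measurable (Function.uncurry Φ)) {B : ℝ} (hB0 : 0 ≤ B)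
    (hB : ∀ s y, |Φ s y| ≤ B) {s t : ℝ} (hs : 0 ≤ s) (hst : s ≤ t) (x : E) :
    ∫ y, (∫ r in (0 : ℝ)..s, ∫ z, Φ r z ∂(P.kernel (s - r).toNNReal y))
        ∂(P.kernel (t - s).toNNReal x)
      = ∫ r in (0 : ℝ)..s, ∫ z, Φ r z ∂(P.kernel (t - r).toNNReal x) := by
  simp_rw [intervalIntegral.integral_of_le hs]
  rw [integral_integral_swap]
  · refine setIntegral_congr_fun measurableSet_Ioc fun r hr => ?_
    have hsum : (t - r).toNNReal = (t - s).toNNReal + (s - r).toNNReal := by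
      rw [← Real.toNNReal_add (by linarith) (by linarith [hr.2])]
      congr 1; ring
    simp only [hsum]
    exact P.integral_integral (hΦ.comp measurable_prodMk_left) (hB r) _ _ x
  · refine Integrable.of_bound (C := B) ?_ (ae_of_all _ fun q => P.abs_integral_le hB0 (hB _) _ _)
    exact ((measurable_integral_kernel hP hΦ).comp (measurable_snd.prodMk
      ((measurable_const.sub measurable_snd).prodMk measurable_fst))).aestronglyMeasurable

/-- The mild equation with generator shifted by `κ`. -/
theorem mild_equation_shift (hP : Measurable fun p : ℝ≥0 × E => P.kernel p.1 p.2)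
    {f : E → ℝ} (hf : Measurable f) {K : ℝ} (hK : ∀ y, |f y| ≤ K)
    {U Φ : ℝ → E → ℝ} (hU : Measurable (Function.uncurry U)) (hUK : ∀ s y, |U s y| ≤ K)
    (hΦ : Measurable (Function.uncurry Φ)) {B : ℝ} (hB0 : 0 ≤ B) (hB : ∀ s y, |Φ s y| ≤ B)
    {T : ℝ} (heq : ∀ t, 0 ≤ t → t ≤ T → ∀ x, U t x = ∫ y, f y ∂(P.kernel t.toNNReal x)
      - ∫ s in (0 : ℝ)..t, ∫ y, Φ s y ∂(P.kernel (t - s).toNNReal x))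
    (κ : ℝ) {t : ℝ} (ht : 0 ≤ t) (htT : t ≤ T) (x : E) :
    U t x = Real.exp (-(κ * t)) * ∫ y, f y ∂(P.kernel t.toNNReal x)
      + ∫ s in (0 : ℝ)..t, Real.exp (-(κ * (t - s))) *
          ∫ y, (κ * U s y - Φ s y) ∂(P.kernel (t - s).toNNReal x) := by
  have hFm : Measurable fun s => ∫ y, Φ s y ∂(P.kernel (t - s).toNNReal x) :=
    (measurable_integral_kernel hP hΦ).comp
      (measurable_id.prodMk ((measurable_const.sub measurable_id).prodMk measurable_const))
  have hF := intervalIntegrable_of_abs_le hFm (fun s => P.abs_integral_le hB0 (hB s) _ _) 0 t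
  have hU' : ∀ s, Measurable (U s) := fun s => hU.comp measurable_prodMk_left
  have hΦ' : ∀ s, Measurable (Φ s) := fun s => hΦ.comp measurable_prodMk_left
  have hkey := integral_exp_mul_integratingFactor hF κ (∫ y, f y ∂(P.kernel t.toNNReal x))
  rw [← heq t ht htT x] at hkey
  rw [eq_comm, ← eq_sub_iff_add_eq', ← hkey]
  refine intervalIntegral.integral_congr fun s hs => ?_
  rw [Set.uIcc_of_le ht] at hs
  -- Applying `P_{t-s}` to the equation at time `s` shows that `s ↦ P_{t-s} U_s(x)` is a constant
  -- minus a primitive, the form required by the integrating factor.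
  have hmild : ∫ y, U s y ∂(P.kernel (t - s).toNNReal x)
      = ∫ y, f y ∂(P.kernel t.toNNReal x)
        - ∫ r in (0 : ℝ)..s, ∫ z, Φ r z ∂(P.kernel (t - r).toNNReal x) := by
    have hsum : t.toNNReal = (t - s).toNNReal + s.toNNReal := by
      rw [← Real.toNNReal_add (by linarith [hs.2]) hs.1]; congr 1; ring
    rw [← integral_integral_mild hP hΦ hB0 hB hs.1 hs.2 x, hsum,
      ← P.integral_integral hf hK _ _ x]
    simp_rw [heq s hs.1 (hs.2.trans htT)]
    have hPf : Measurable fun y => ∫ z, f z ∂(P.kernel s.toNNReal y) :=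
      (hf.stronglyMeasurable.integral_kernel).measurable
    have hK0 : 0 ≤ K := (abs_nonneg _).trans (hK x)
    have h1 := P.integrable_of_abs_le hPf (fun y => P.abs_integral_le hK0 hK _ y)
      (t - s).toNNReal x
    have h2 := P.integrable_of_abs_le (hU' s) (hUK s) (t - s).toNNReal x
    refine integral_sub h1 ((h1.sub h2).congr (ae_of_all _ fun y => ?_))
    simp [heq s hs.1 (hs.2.trans htT) y]
  rw [integral_sub ((P.integrable_of_abs_le (hU' s) (hUK s) _ x).const_mul κ)
    (P.integrable_of_abs_le (hΦ' s) (hB s) _ x), integral_const_mul, hmild]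

end MildEquation

/-! ### The scalar mechanism and its ODE. -/

namespace CBMechanism

variable (φ : CBMechanism)

theorem integrable_min_sq :
    Integrable (fun u : ℝ => min u (u ^ 2)) (φ.m.restrict (Set.Ioi 0)) :=
  (lintegral_ofReal_ne_top_iff_integrable
    (measurable_id.min (measurable_id.pow_const 2)).aestronglyMeasurable
    ((ae_restrict_mem measurableSet_Ioi).mono fun _ hu =>
      le_min (Set.mem_Ioi.1 hu).le (sq_nonneg _))).1 φ.finite_m.ne

theorem measurable_integrand (z : ℝ) :
    Measurable fun u : ℝ => Real.exp (-(z * u)) - 1 + z * u := by fun_prop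

theorem ae_norm_integrand_le {M z : ℝ} (hM : 1 ≤ M) (hz : 0 ≤ z) (hzM : z ≤ M) :
    ∀ᵐ u ∂(φ.m.restrict (Set.Ioi 0)),
      ‖Real.exp (-(z * u)) - 1 + z * u‖ ≤ M ^ 2 * min u (u ^ 2) := by
  filter_upwards [ae_restrict_mem measurableSet_Ioi] with u hu
  have hu0 : 0 ≤ u := (Set.mem_Ioi.1 hu).le
  rw [Real.norm_of_nonneg (exp_neg_sub_one_add_nonneg _)]
  exact exp_neg_sub_one_add_le hM hu0 (by positivity) (by gcongr)

theorem integrable_integrand {z : ℝ} (hz : 0 ≤ z) :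
    Integrable (fun u : ℝ => Real.exp (-(z * u)) - 1 + z * u) (φ.m.restrict (Set.Ioi 0)) :=
  (φ.integrable_min_sq.const_mul _).mono' (measurable_integrand z).aestronglyMeasurable
    (φ.ae_norm_integrand_le (le_max_left 1 z) hz (le_max_right 1 z))

theorem continuousOn_eval {M : ℝ} (hM : 1 ≤ M) : ContinuousOn φ.eval (Set.Icc 0 M) := by
  have h : ContinuousOn
      (fun z => ∫ u in Set.Ioi (0 : ℝ), (Real.exp (-(z * u)) - 1 + z * u) ∂φ.m)
      (Set.Icc 0 M) :=
    continuousOn_of_dominated (fun z _ => (measurable_integrand z).aestronglyMeasurable)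
      (fun z hz => φ.ae_norm_integrand_le hM hz.1 hz.2) (φ.integrable_min_sq.const_mul _)
      (ae_of_all _ fun u => by fun_prop)
  unfold eval
  exact (Continuous.continuousOn (by fun_prop)).add h

/-- The quadratic and jump terms are nondecreasing on `[0,∞)`, so only the linear term can lower the
slope. -/
theorem eval_add_mul_le {z a : ℝ} (hz : 0 ≤ z) (ha : 0 ≤ a) :
    φ.eval z + φ.b * a ≤ φ.eval (z + a) := by
  have h : ∫ u in Set.Ioi (0 : ℝ), (Real.exp (-(z * u)) - 1 + z * u) ∂φ.m
      ≤ ∫ u in Set.Ioi (0 : ℝ), (Real.exp (-((z + a) * u)) - 1 + (z + a) * u) ∂φ.m := by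
    refine integral_mono_ae (φ.integrable_integrand hz)
      (φ.integrable_integrand (add_nonneg hz ha)) ?_
    filter_upwards [ae_restrict_mem measurableSet_Ioi] with u hu
    have hu0 : 0 ≤ u := (Set.mem_Ioi.1 hu).le
    have h1 : Real.exp (-((z + a) * u)) = Real.exp (-(z * u)) * Real.exp (-(a * u)) := by
      rw [← Real.exp_add]; ring_nf
    have h2 := Real.add_one_le_exp (-(a * u))
    have h3 : Real.exp (-(z * u)) ≤ 1 := Real.exp_le_one_iff.2 (by nlinarith)
    have h4 : 0 ≤ a * u := mul_nonneg ha hu0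
    rw [h1]
    nlinarith [Real.exp_pos (-(z * u))]
  have h2 : φ.c * z ^ 2 ≤ φ.c * (z + a) ^ 2 := by
    have := φ.c_nonneg
    gcongr
    linarith
  unfold eval
  linarith

end CBMechanism

section ODE

variable {φ : CBMechanism} {v : ℝ≥0 → ℝ → ℝ}

theorem IsCBCumulantSemigroup.hasDerivWithinAt (hv : IsCBCumulantSemigroup φ v) {l : ℝ}
    (hl : 0 ≤ l) {s : ℝ} (hs : 0 ≤ s) :
    HasDerivWithinAt (fun s : ℝ => v s.toNNReal l) (-φ.eval (v s.toNNReal l)) (Set.Ici 0) s := by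
  have h := hv.equation l hl s.toNNReal
  rwa [Real.coe_toNNReal s hs] at h

theorem IsCBCumulantSemigroup.continuousOn (hv : IsCBCumulantSemigroup φ v) {l : ℝ}
    (hl : 0 ≤ l) : ContinuousOn (fun s : ℝ => v s.toNNReal l) (Set.Ici 0) :=
  fun _ hs => (hv.hasDerivWithinAt hl hs).continuousWithinAt

theorem IsCBCumulantSemigroup.exists_le (hv : IsCBCumulantSemigroup φ v) {l : ℝ}
    (hl : 0 ≤ l) (T : ℝ) : ∃ C, 0 ≤ C ∧ ∀ s, 0 ≤ s → s ≤ T → v s.toNNReal l ≤ C := by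
  obtain ⟨C, hC⟩ := isCompact_Icc.exists_bound_of_continuousOn
    ((hv.continuousOn hl).mono (Set.Icc_subset_Ici_self : Set.Icc 0 T ⊆ _))
  refine ⟨max C 0, le_max_right _ _, fun s h0 hT => ?_⟩
  exact ((le_abs_self _).trans (hC s ⟨h0, hT⟩)).trans (le_max_left _ _)

theorem IsCBCumulantSemigroup.continuousOn_eval (hv : IsCBCumulantSemigroup φ v) {l : ℝ}
    (hl : 0 ≤ l) (T : ℝ) :
    ContinuousOn (fun s : ℝ => φ.eval (v s.toNNReal l)) (Set.Icc 0 T) := by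
  obtain ⟨C, hC0, hC⟩ := hv.exists_le hl T
  refine (φ.continuousOn_eval (M := C + 1) (by linarith)).comp
    ((hv.continuousOn hl).mono Set.Icc_subset_Ici_self) fun s hs => ?_
  exact ⟨hv.nonneg l hl _, (hC s hs.1 hs.2).trans (by linarith)⟩

theorem IsCBCumulantSemigroup.equation_shift (hv : IsCBCumulantSemigroup φ v) {l : ℝ}
    (hl : 0 ≤ l) (κ : ℝ) {t : ℝ} (ht : 0 ≤ t) :
    v t.toNNReal l = Real.exp (-(κ * t)) * l
      + ∫ s in (0 : ℝ)..t, Real.exp (-(κ * (t - s))) *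
          (κ * v s.toNNReal l - φ.eval (v s.toNNReal l)) := by
  have hc := (hv.continuousOn hl).mono (Set.Icc_subset_Ici_self : Set.Icc 0 t ⊆ _)
  have hexp : Continuous fun s => Real.exp (-(κ * (t - s))) := by fun_prop
  rw [intervalIntegral.integral_eq_sub_of_hasDeriv_right
    (f := fun s => Real.exp (-(κ * (t - s))) * v s.toNNReal l)]
  · simp [hv.initial l hl]
  · rw [Set.uIcc_of_le ht]
    exact hexp.continuousOn.mul hc
  · intro s hs
    rw [min_eq_left ht, max_eq_right ht] at hs
    have h1 := (hv.hasDerivWithinAt hl hs.1.le).mono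
      (Set.Ioi_subset_Ici hs.1.le : Set.Ioi s ⊆ Set.Ici 0)
    refine ((Real.hasDerivAt_exp_neg_mul_sub κ t s).hasDerivWithinAt.mul h1).congr_deriv ?_
    ring
  · refine ContinuousOn.intervalIntegrable ?_
    rw [Set.uIcc_of_le ht]
    exact hexp.continuousOn.mul ((continuousOn_const.mul hc).sub (hv.continuousOn_eval hl t))

end ODE

/-! ### The iterated comparison. -/

theorem integral_mul_pow_div_factorial (K L : ℝ) (n : ℕ) (t : ℝ) :
    ∫ s in (0 : ℝ)..t, L * (K * ((L * s) ^ n / n.factorial))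
      = K * ((L * t) ^ (n + 1) / (n + 1).factorial) := by
  have h : ∀ s : ℝ, L * (K * ((L * s) ^ n / n.factorial))
      = L * K * L ^ n / n.factorial * s ^ n := fun s => by rw [mul_pow]; ring
  simp_rw [h]
  rw [intervalIntegral.integral_const_mul, integral_pow, Nat.factorial_succ, mul_pow]
  push_cast
  field_simp
  ring

/-- A bounded solution of the mild equation stays below a solution of the comparison ODE. -/
theorem le_of_mild_equation {E : Type*} [MeasurableSpace E] [MeasurableEq E]
    {P : TransitionSemigroup E} (hP : Measurable fun p : ℝ≥0 × E => P.kernel p.1 p.2)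
    (φ : BranchingMechanism E) (φs : CBMechanism)
    (hdom : ∀ (x : E) (z : ℝ), 0 ≤ z → φs.eval z ≤ φ.localProjection x z)
    {v : ℝ≥0 → ℝ → ℝ} (hv : IsCBCumulantSemigroup φs v) {l : ℝ} (hl : 0 ≤ l)
    {f : E → ℝ} (hf : Measurable f) (hf0 : ∀ y, 0 ≤ f y) (hfl : ∀ y, f y ≤ l)
    {U : ℝ → E → ℝ} (hU : Measurable (Function.uncurry U)) (hU0 : ∀ s y, 0 ≤ U s y)
    {C : ℝ} (hUC : ∀ s y, U s y ≤ C) {T : ℝ}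
    (heq : ∀ t, 0 ≤ t → t ≤ T → ∀ x, U t x = ∫ y, f y ∂(P.kernel t.toNNReal x)
      - ∫ s in (0 : ℝ)..t, ∫ y, φ.eval y (U s) ∂(P.kernel (t - s).toNNReal x))
    {t : ℝ} (ht : 0 ≤ t) (htT : t ≤ T) (x : E) : U t x ≤ v t.toNNReal l := by
  obtain ⟨D, hD0, hD⟩ := hv.exists_le hl T
  set K := max C l
  have hlK : l ≤ K := le_max_right _ _
  have hK0 : 0 ≤ K := hl.trans hlK
  have hUK : ∀ s y, U s y ≤ K := fun s y => (hUC s y).trans (le_max_left _ _)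
  -- The level must bound `v + a` with `v ≤ D` and `a ≤ K`; the extra `1` meets the requirement `1 ≤
  -- M`.
  have hM : 1 ≤ D + K + 1 := by linarith
  obtain ⟨κ, hκ0, hκ⟩ := φ.exists_localProjection_le_eval_add hM
  obtain ⟨B, hB0, hB⟩ := φ.exists_abs_eval_le hM
  have hU' : ∀ s, Measurable (U s) := fun s => hU.comp measurable_prodMk_left
  have hUabs : ∀ s y, |U s y| ≤ K := fun s y => by rw [abs_of_nonneg (hU0 s y)]; exact hUK s y
  have hΦ : Measurable (Function.uncurry fun s y => φ.eval y (U s)) := φ.measurable_eval hU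
  have hΦB : ∀ s y, |φ.eval y (U s)| ≤ B := fun s y =>
    hB y (U s) (hU' s) (hU0 s) fun z => (hUK s z).trans (by linarith)
  have hG : ∀ s, Measurable fun y => κ * U s y - φ.eval y (U s) := fun s =>
    ((hU' s).const_mul κ).sub (hΦ.comp measurable_prodMk_left)
  have hGB : ∀ s y, |κ * U s y - φ.eval y (U s)| ≤ κ * K + B := fun s y => by
    refine (abs_sub _ _).trans (add_le_add ?_ (hΦB s y))
    rw [abs_mul, abs_of_nonneg hκ0]
    gcongr
    exact hUabs s y
  set L := κ + |φs.b| with hL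
  have hL0 : 0 ≤ L := by positivity
  have hv0 : ∀ s : ℝ, 0 ≤ v s.toNNReal l := fun s => hv.nonneg l hl _
  -- Nonnegativity is needed because `P` may lose mass: `P_t g ≤ g` for a constant `g` only if `g ≥
  -- 0`. Comparison with the zero function gives `φ_*(θ) ≤ κθ`.
  have hg0 : ∀ s, 0 ≤ s → s ≤ T → 0 ≤ κ * v s.toNNReal l - φs.eval (v s.toNNReal l) := by
    intro s hs hsT
    have h1 := hκ x (fun _ => 0) (v s.toNNReal l) measurable_const (fun _ => le_rfl)
      (fun _ => hv0 s) ((hD s hs hsT).trans (by linarith))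
    have h2 : φ.eval x (fun _ => 0) = 0 := by simp [BranchingMechanism.eval]
    linarith [hdom x _ (hv0 s)]
  have hfK : ∀ y, |f y| ≤ K := fun y => by
    rw [abs_of_nonneg (hf0 y)]; exact (hfl y).trans hlK
  have hiter : ∀ n : ℕ, ∀ s, 0 ≤ s → s ≤ T → ∀ x,
      U s x ≤ v s.toNNReal l + K * ((L * s) ^ n / n.factorial) := by
    intro n
    induction n with
    | zero =>
      intro s _ _ x
      simpa using (hUK s x).trans (le_add_of_nonneg_left (hv0 s))
    | succ n ih =>
      intro s hs hsT x
      rw [mild_equation_shift hP hf hfK hU hUabs hΦ hB0 hΦB heq κ hs hsT x,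
        hv.equation_shift hl κ hs, ← integral_mul_pow_div_factorial K L n s, add_assoc]
      have hexp : Continuous fun r => Real.exp (-(κ * (s - r))) := by fun_prop
      have hi1 : IntervalIntegrable (fun r => Real.exp (-(κ * (s - r))) *
          ∫ y, (κ * U r y - φ.eval y (U r)) ∂(P.kernel (s - r).toNNReal x)) volume 0 s := by
        refine IntervalIntegrable.continuousOn_mul ?_ hexp.continuousOn
        refine intervalIntegrable_of_abs_le (B := κ * K + B) ?_
          (fun r => P.abs_integral_le (by positivity) (hGB r) _ _) 0 s
        exact (measurable_integral_kernel hP (g := fun r y => κ * U r y - φ.eval y (U r))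
          ((hU.const_mul κ).sub hΦ)).comp
          (measurable_id.prodMk ((measurable_const.sub measurable_id).prodMk measurable_const))
      have hi2 : IntervalIntegrable (fun r => Real.exp (-(κ * (s - r))) *
          (κ * v r.toNNReal l - φs.eval (v r.toNNReal l))) volume 0 s := by
        refine ContinuousOn.intervalIntegrable ?_
        rw [Set.uIcc_of_le hs]
        exact hexp.continuousOn.mul ((continuousOn_const.mul ((hv.continuousOn hl).mono
          Set.Icc_subset_Ici_self)).sub (hv.continuousOn_eval hl s))
      have hi3 : IntervalIntegrable (fun r => L * (K * ((L * r) ^ n / n.factorial))) volume 0 s :=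
        Continuous.intervalIntegrable (by fun_prop) _ _
      rw [← intervalIntegral.integral_add hi2 hi3]
      refine add_le_add ?_ (intervalIntegral.integral_mono_on hs hi1 (hi2.add hi3) fun r hr => ?_)
      · gcongr
        exact P.integral_le hf hfK hl hfl _ _
      · have hrT : r ≤ T := hr.2.trans hsT
        have hA0 : 0 ≤ K * ((L * r) ^ n / n.factorial) := by have := hr.1; positivity
        set A := K * ((L * r) ^ n / n.factorial)
        set g := κ * v r.toNNReal l - φs.eval (v r.toNNReal l) with hg
        have hgr : 0 ≤ g := hg0 r hr.1 hrT
        have hle : ∀ y, κ * U r y - φ.eval y (U r) ≤ g + L * A := by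
          intro y
          -- Capping the error by `K` keeps `v + a` below the level for which `κ` was chosen,
          -- uniformly in `n`; it remains an upper bound since `U ≤ K`.
          set a := min K A
          have ha0 : 0 ≤ a := le_min hK0 hA0
          have haK : a ≤ K := min_le_left _ _
          have haA : a ≤ A := min_le_right _ _
          have hUa : ∀ z, U r z ≤ v r.toNNReal l + a := fun z => by
            rw [← sub_le_iff_le_add']
            exact le_min (by linarith [hUK r z, hv0 r]) (by linarith [ih r hr.1 hrT z])
          have h1 := hκ y (U r) (v r.toNNReal l + a) (hU' r) (hU0 r) hUa
            (by linarith [hD r hr.1 hrT])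
          have h2 := hdom y (v r.toNNReal l + a) (add_nonneg (hv0 r) ha0)
          have h3 := φs.eval_add_mul_le (hv0 r) ha0
          have h4 : -φs.b * a ≤ |φs.b| * a := by gcongr; exact neg_le_abs _
          have h5 : L * a ≤ L * A := by gcongr
          rw [hL] at h5 ⊢
          linarith
        have h1 := P.integral_le (hG r) (hGB r) (by positivity) hle (s - r).toNNReal x
        have h2 : Real.exp (-(κ * (s - r))) ≤ 1 :=
          Real.exp_le_one_iff.2 (by nlinarith [hr.2])
        have h3 : 0 ≤ L * A := by positivity
        calc _ ≤ Real.exp (-(κ * (s - r))) * (g + L * A) := by gcongr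
          _ = Real.exp (-(κ * (s - r))) * g + Real.exp (-(κ * (s - r))) * (L * A) := mul_add _ _ _
          _ ≤ _ := by grw [mul_le_of_le_one_left h3 h2]
  have hlim : Tendsto (fun n : ℕ => v t.toNNReal l + K * ((L * t) ^ n / n.factorial)) atTop
      (𝓝 (v t.toNNReal l)) := by
    simpa using ((FloorSemiring.tendsto_pow_div_factorial_atTop (L * t)).const_mul K).const_add
      (v t.toNNReal l)
  exact ge_of_tendsto' hlim fun n => hiter n t ht htT x

theorem IsLusinSpace.metrizable_secondCountable {E : Type*} [TopologicalSpace E]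
    (hE : IsLusinSpace E) :
    TopologicalSpace.MetrizableSpace E ∧ SecondCountableTopology E := by
  obtain ⟨K, _, _, i, hi, -⟩ := hE
  exact ⟨hi.metrizableSpace, hi.secondCountableTopology⟩

end Superprocess

theorem theorem3p4 {E : Type*} [TopologicalSpace E] [MeasurableSpace E] [BorelSpace E]
    (hE : Superprocess.IsLusinSpace E)
    {Ω : Type*} [MeasurableSpace Ω]
    (P : Superprocess.TransitionSemigroup E)
    (ξ : Superprocess.BorelRightProcess P Ω)
    (φ : Superprocess.BranchingMechanism E)
    (φs : Superprocess.CBMechanism)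
    (hdom : ∀ (x : E) (z : ℝ), 0 ≤ z → φs.eval z ≤ φ.localProjection x z)
    (V : ℝ≥0 → (E → ℝ) → E → ℝ)
    (hV : Superprocess.IsCumulantSemigroup P φ V)
    (v : ℝ≥0 → ℝ → ℝ)
    (hv : Superprocess.IsCBCumulantSemigroup φs v)
    (t : ℝ≥0) (f : E → ℝ) (hf : Superprocess.IsBoundedBorelNonneg f) :
    Superprocess.supNorm (V t f) ≤ v t (Superprocess.supNorm f) := by
  obtain ⟨_, _⟩ := hE.metrizable_secondCountable
  let := TopologicalSpace.metrizableSpaceMetric E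
  have hP := ξ.measurable_kernel
  have hl : 0 ≤ Superprocess.supNorm f := Real.iSup_nonneg fun _ => abs_nonneg _
  have hfl : ∀ y, f y ≤ Superprocess.supNorm f := by
    intro y
    obtain ⟨C, hC⟩ := hf.bounded
    refine (le_abs_self _).trans (le_ciSup (f := fun y => |f y|) ⟨C, ?_⟩ y)
    rintro _ ⟨z, rfl⟩
    simpa only [abs_of_nonneg (hf.nonneg z)] using hC z
  obtain ⟨C, hC⟩ := hV.locallyBounded f hf t
  have key : ∀ x, V (min (t : ℝ) t).toNNReal f x ≤ v (t : ℝ).toNNReal (Superprocess.supNorm f) := by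
    intro x
    refine Superprocess.le_of_mild_equation hP φ φs hdom hv hl hf.measurable hf.nonneg hfl
      -- Freezing time at `t` turns the local bound on `V` into a global one without altering the
      -- equation on `[0,t]`.
      (U := fun s => V (min s t).toNNReal f) (C := C) (T := t) ?_
      (fun s y => hV.nonneg f hf _ y)
      (fun s y => hC _ (Real.toNNReal_le_iff_le_coe.2 (min_le_right _ _)) y) ?_ t.2 le_rfl x
    · exact (hV.measurable f hf).comp
        (((measurable_fst.min measurable_const).real_toNNReal).prodMk measurable_snd)
    · intro s hs hst x
      have h := hV.equation f hf s.toNNReal x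
      rw [Real.coe_toNNReal s hs] at h
      simp only [min_eq_left hst]
      rw [h]
      congr 1
      refine intervalIntegral.integral_congr fun r hr => ?_
      rw [Set.uIcc_of_le hs] at hr
      simp only [min_eq_left (hr.2.trans hst)]
  refine Real.iSup_le (fun x => ?_) (hv.nonneg _ hl t)
  rw [abs_of_nonneg (hV.nonneg f hf t x)]
  simpa using key x
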